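/- Let $r \ge 2$ be an integer and let $n$ be a positive rational number. For a finite set $E$ of edges of a hypergraph, a fractional matching for $E$ is a function $f : E \to \mathbb{R}_{\ge 0}$ such that $\sum_{e \in E,\, e \ni v} f(e) \le 1$ for every vertex $v$; its size is $\sum_{e \in E} f(e)$, and $\nu^*(E)$ denotes the maximal size of a fractional matching for $E$. Let $E_1, \ldots, E_{\lceil rn \rceil}$ be (not necessarily distinct) finite sets of edges in an $r$-uniform hypergraph (that is, every edge consists of exactly $r$ vertices), such that $\nu^*(E_i) \ge n$ for $i = 1, \ldots, \lceil rn \rceil$. Then the family has a rainbow fractional matching of size $n$: there are a set $\{e_1, \ldots, e_k\}$ of ($k$ distinct) edges and distinct indices $\sigma(1), \ldots, \sigma(k) \in \{1, \ldots, \lceil rn \rceil\}$ with $e_j \in E_{\sigma(j)}$ for $j = 1, \ldots, k$, together with a fractional matching $f : \{e_1, \ldots, e_k\} \to \mathbb{R}_{\ge 0}$ of size exactly $n$. -/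

import Mathlib

namespace RainbowFractional

/-- A hypergraph is `r`-uniform if each of its edges consists of exactly `r` vertices. -/
def IsUniform {V : Type*} (H : Hypergraph V) (r : ℕ) : Prop :=
  ∀ e ∈ H.edgeSet, e.encard = (r : ℕ∞)

open Classical in
/-- `f` is a fractional matching for the finite set `E` of edges: it is nonnegative on `E`, and at
each vertex the total weight of the edges of `E` containing it is at most `1`.
(Only the values of `f` on `E` matter.) -/
def IsFractionalMatching {V : Type*} (E : Finset (Set V)) (f : Set V → ℝ) : Prop :=
  (∀ e ∈ E, 0 ≤ f e) ∧ ∀ v : V, ∑ e ∈ E with v ∈ e, f e ≤ 1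

/-- The size of a weight function `f` on the finite set `E` of edges. -/
def size {V : Type*} (E : Finset (Set V)) (f : Set V → ℝ) : ℝ :=
  ∑ e ∈ E, f e

/-- The fractional matching number `ν*(E)`: the largest size of a fractional matching for `E`.
The set of sizes contains `0`, and it is bounded above whenever all edges in `E` are nonempty. -/
noncomputable def fracMatchingNumber {V : Type*} (E : Finset (Set V)) : ℝ :=
  sSup {s : ℝ | ∃ f : Set V → ℝ, IsFractionalMatching E f ∧ size E f = s}

/-- `R` is a rainbow set of edges for the family `E`: its edges can be assigned pairwise distinct
indices so that each edge belongs to the member of the family with its index. -/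
def IsRainbow {V ι : Type*} (E : ι → Finset (Set V)) (R : Finset (Set V)) : Prop :=
  ∃ σ : R → ι, Function.Injective σ ∧ ∀ e : R, (e : Set V) ∈ E (σ e)

/-- The family `E` has a rainbow fractional matching of size `n`: a rainbow set of edges together
with a fractional matching of size `n` for it. -/
def HasRainbowFractionalMatching {V ι : Type*} (E : ι → Finset (Set V)) (n : ℝ) : Prop :=
  ∃ (R : Finset (Set V)) (f : Set V → ℝ),
    IsRainbow E R ∧ IsFractionalMatching R f ∧ size R f = n

end RainbowFractional

/-! Linear programming duality with a pivot. Among all rainbow sets, take an `R` of largest packing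
value and an extreme optimal packing `f` on it, and suppose this value is below `n`. The rows in the
support of `f`, restricted to the tight vertices, are linearly independent
(`linearIndependent_of_extreme`). Hence the support has at most as many edges as there are tight
vertices, and by double counting this is at most `r` times the size of `f`, so less than `r * n`:
some index `i` is unused.

If the restricted rows form a basis, let `φ` be the functional equal to `1` on each of them; it is
an optimal dual solution. An edge of `E i` with `φ < 1` could be pivoted in, giving a better rainbow
set. So `φ` is a fractional cover of `E i`, and weak duality bounds the packings on `E i` by the
size of `f`, which is below `n`: a contradiction.

The rows can fail to span when the optimum is degenerate. Capacities are therefore perturbed to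
generic values in `[1, 1 + ε]` (`exists_isGeneric`), and finiteness of the set of candidates `R`
removes `ε` at the end. -/

namespace RainbowFractional

open Matrix Filter Topology

/-! ### Packing linear programs with constant row sums -/

section Packing

variable {A U ι : Type*}

/-- `R` is a partial transversal of the family `E`. -/
def IsTransversal (E : ι → Finset A) (R : Finset A) : Prop :=
  ∃ σ : A → ι, Set.InjOn σ R ∧ ∀ e ∈ R, e ∈ E (σ e)

theorem IsTransversal.mono {E : ι → Finset A} {R S : Finset A} (h : IsTransversal E R)
    (hS : S ⊆ R) : IsTransversal E S := by
  obtain ⟨σ, h1, h2⟩ := h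
  exact ⟨σ, h1.mono (by exact_mod_cast hS), fun e he => h2 e (hS he)⟩

/-- A weight on the support of `f` extends by zero to all of the index type. -/
theorem exists_extend_support (f : A → ℝ) (g : {e // f e ≠ 0} → ℝ) :
    ∃ d : A → ℝ, (∀ e, f e = 0 → d e = 0) ∧ (∀ s : {e // f e ≠ 0}, d s = g s) := by
  classical
  refine ⟨fun e => if h : f e ≠ 0 then g ⟨e, h⟩ else 0, fun e he => by simp [he], fun s => ?_⟩
  simp [s.2]

variable [Fintype A]

/-- The nonnegative weights on the rows of `a`, supported on `R`, whose load on each column `u` is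
at most the capacity `c u`. -/
def packing (a : Matrix A U ℝ) (c : U → ℝ) (R : Finset A) : Set (A → ℝ) :=
  {f | (∀ e, 0 ≤ f e) ∧ (∀ e, e ∉ R → f e = 0) ∧ ∀ u, (f ᵥ* a) u ≤ c u}

theorem isClosed_packing (a : Matrix A U ℝ) (c : U → ℝ) (R : Finset A) :
    IsClosed (packing a c R) := by
  simp only [packing, Set.ofPred_and, Set.ofPred_forall, Matrix.vecMul, dotProduct]
  refine (isClosed_iInter fun e => isClosed_le (by fun_prop) (by fun_prop)).inter
    ((isClosed_iInter fun e => isClosed_iInter fun _ => isClosed_eq (by fun_prop) (by fun_prop)).inter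
      (isClosed_iInter fun u => isClosed_le (by fun_prop) (by fun_prop)))

theorem sum_load [Fintype U] {a : Matrix A U ℝ} {r : ℝ} (har : ∀ e, ∑ u, a e u = r) (f : A → ℝ) :
    ∑ u, (f ᵥ* a) u = r * ∑ e, f e := by
  simp only [Matrix.vecMul, dotProduct]
  rw [Finset.sum_comm, Finset.mul_sum]
  refine Finset.sum_congr rfl fun e _ => ?_
  rw [← Finset.mul_sum, har, mul_comm]

theorem isCompact_packing [Fintype U] {a : Matrix A U ℝ} {r : ℝ} (hr : 0 < r)
    (har : ∀ e, ∑ u, a e u = r) (c : U → ℝ) (R : Finset A) : IsCompact (packing a c R) := by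
  refine (isCompact_Icc (a := (0 : A → ℝ)) (b := fun _ => (∑ u, c u) / r)).of_isClosed_subset
    (isClosed_packing a c R) fun f hf => ⟨fun e => hf.1 e, fun e => ?_⟩
  rw [le_div_iff₀ hr]
  calc f e * r ≤ (∑ e, f e) * r := by
        gcongr
        exact Finset.single_le_sum (fun i _ => hf.1 i) (Finset.mem_univ e)
    _ = ∑ u, (f ᵥ* a) u := by rw [sum_load har, mul_comm]
    _ ≤ ∑ u, c u := Finset.sum_le_sum fun u _ => hf.2.2 u

/-- A direction that points into the cone of feasible directions at `f` can be followed for a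
short time. -/
theorem eventually_mem_packing [Finite U] {a : Matrix A U ℝ} {c : U → ℝ} {R S : Finset A}
    {f d : A → ℝ} (hf : f ∈ packing a c R) (hS : ∀ e, e ∉ S → f e = 0 ∧ d e = 0)
    (hd : ∀ e, f e = 0 → 0 ≤ d e) (hu : ∀ u, (f ᵥ* a) u = c u → (d ᵥ* a) u ≤ 0) :
    ∀ᶠ t : ℝ in 𝓝[>] 0, f + t • d ∈ packing a c S := by
  have h1 : ∀ᶠ t : ℝ in 𝓝[>] 0, ∀ e, 0 ≤ f e + t * d e := by
    refine eventually_all.2 fun e => ?_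
    rcases (hf.1 e).eq_or_lt with h | h
    · filter_upwards [self_mem_nhdsWithin] with t ht
      rw [← h, zero_add]
      exact mul_nonneg (le_of_lt ht) (hd e h.symm)
    · have : Tendsto (fun t : ℝ => f e + t * d e) (𝓝[>] 0) (𝓝 (f e + 0 * d e)) :=
        (Continuous.tendsto (by fun_prop) 0).mono_left nhdsWithin_le_nhds
      rw [zero_mul, add_zero] at this
      exact (this.eventually_const_lt h).mono fun t ht => ht.le
  have h2 : ∀ᶠ t : ℝ in 𝓝[>] 0, ∀ u, (f ᵥ* a) u + t * (d ᵥ* a) u ≤ c u := by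
    refine eventually_all.2 fun u => ?_
    rcases (hf.2.2 u).eq_or_lt with h | h
    · filter_upwards [self_mem_nhdsWithin] with t ht
      rw [h]
      have := mul_nonpos_of_nonneg_of_nonpos (le_of_lt ht) (hu u h)
      linarith
    · have : Tendsto (fun t : ℝ => (f ᵥ* a) u + t * (d ᵥ* a) u) (𝓝[>] 0)
          (𝓝 ((f ᵥ* a) u + 0 * (d ᵥ* a) u)) :=
        (Continuous.tendsto (by fun_prop) 0).mono_left nhdsWithin_le_nhds
      rw [zero_mul, add_zero] at this
      exact (this.eventually_lt_const h).mono fun t ht => ht.le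
  filter_upwards [h1, h2] with t h1 h2
  refine ⟨h1, fun e he => by simp [hS e he], fun u => ?_⟩
  rw [Matrix.add_vecMul, Matrix.smul_vecMul]
  exact h2 u

/-- First-order optimality. `S` need not be `R`: the direction may bring in an edge outside `R`, as
the pivot requires. -/
theorem sum_nonpos_of_feasible_direction [Finite U] {a : Matrix A U ℝ} {c : U → ℝ}
    {R S : Finset A} {f d : A → ℝ} (hf : f ∈ packing a c R)
    (hmax : ∀ g ∈ packing a c S, ∑ e, g e ≤ ∑ e, f e)
    (hS : ∀ e, e ∉ S → f e = 0 ∧ d e = 0)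
    (hd : ∀ e, f e = 0 → 0 ≤ d e) (hu : ∀ u, (f ᵥ* a) u = c u → (d ᵥ* a) u ≤ 0) :
    ∑ e, d e ≤ 0 := by
  obtain ⟨t, ht, ht0⟩ :=
    ((eventually_mem_packing hf hS hd hu).and self_mem_nhdsWithin).exists
  have := hmax _ ht
  simp only [Pi.add_apply, Pi.smul_apply, smul_eq_mul, Finset.sum_add_distrib,
    ← Finset.mul_sum] at this
  have h0 : t * ∑ e, d e ≤ 0 := by linarith
  exact nonpos_of_mul_nonpos_right h0 ht0

/-- The row `e` of `a`, restricted to the columns satisfying `p`. -/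
def restrictRow (a : Matrix A U ℝ) (p : U → Prop) (e : A) : {u // p u} → ℝ := fun u => a e u

theorem sum_smul_restrictRow (a : Matrix A U ℝ) (p : U → Prop) (d : A → ℝ) :
    ∑ e, d e • restrictRow a p e = fun u : {u // p u} => (d ᵥ* a) u := by
  funext u
  simp [restrictRow, Matrix.vecMul, dotProduct]

open Classical in
theorem sum_support {M : Type*} [AddCommMonoid M] [Module ℝ M] {f d : A → ℝ}
    (hd : ∀ e, f e = 0 → d e = 0) (v : A → M) :
    ∑ e, d e • v e = ∑ s : {e // f e ≠ 0}, d s • v s := by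
  rw [← Finset.sum_subtype (Finset.univ.filter fun e => f e ≠ 0) (by simp) (fun e => d e • v e)]
  symm
  refine Finset.sum_filter_of_ne fun e _ h h0 => h ?_
  rw [hd e h0, zero_smul]

/-- At an extreme point of the face of optimal packings, the rows in the support are linearly
independent, even after restriction to the tight columns. -/
theorem linearIndependent_of_extreme [Finite U] {a : Matrix A U ℝ} {c : U → ℝ} {R : Finset A}
    {f : A → ℝ}
    (hf : f ∈ Set.extremePoints ℝ {g ∈ packing a c R | ∑ e, g e = ∑ e, f e})
    (hmax : ∀ g ∈ packing a c R, ∑ e, g e ≤ ∑ e, f e) :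
    LinearIndependent ℝ
      (fun s : {e // f e ≠ 0} => restrictRow a (fun u => (f ᵥ* a) u = c u) s) := by
  classical
  have hfR : f ∈ packing a c R := hf.1.1
  refine Fintype.linearIndependent_iff.2 fun g hg => ?_
  obtain ⟨d, hd0, hdg⟩ := exists_extend_support f g
  have hz : ∀ u, (f ᵥ* a) u = c u → (d ᵥ* a) u = 0 := by
    intro u hu
    have h := sum_smul_restrictRow a (fun u => (f ᵥ* a) u = c u) d
    rw [sum_support hd0] at h
    simp only [hdg, hg] at h
    exact (congrFun h ⟨u, hu⟩).symm
  have hS : ∀ e, e ∉ R → f e = 0 ∧ d e = 0 := fun e he =>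
    ⟨hfR.2.1 e he, hd0 e (hfR.2.1 e he)⟩
  have hS' : ∀ e, e ∉ R → f e = 0 ∧ (-d) e = 0 := fun e he =>
    ⟨hfR.2.1 e he, by simp [hd0 e (hfR.2.1 e he)]⟩
  have hm1 := sum_nonpos_of_feasible_direction hfR hmax hS
    (fun e he => (hd0 e he).ge) (fun u hu => (hz u hu).le)
  have hm2 := sum_nonpos_of_feasible_direction hfR hmax hS'
    (fun e he => by simp [hd0 e he]) (fun u hu => by simp [Matrix.neg_vecMul, hz u hu])
  have hsum : ∑ e, d e = 0 := by
    simp only [Pi.neg_apply, Finset.sum_neg_distrib] at hm2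
    linarith
  -- A linear relation among the rows gives a direction `d` along which one can move both ways
  -- inside the optimal face; extremality then forces `d = 0`.
  obtain ⟨t, ⟨ht1, ht2⟩, ht0⟩ := (((eventually_mem_packing hfR hS
    (fun e he => (hd0 e he).ge) (fun u hu => (hz u hu).le)).and (eventually_mem_packing hfR hS'
    (fun e he => by simp [hd0 e he])
    (fun u hu => by simp [Matrix.neg_vecMul, hz u hu]))).and self_mem_nhdsWithin).exists
  have hmem : f ∈ openSegment ℝ (f + t • d) (f + t • (-d)) := by
    refine ⟨1 / 2, 1 / 2, by norm_num, by norm_num, by norm_num, ?_⟩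
    ext e
    simp only [Pi.add_apply, Pi.smul_apply, Pi.neg_apply, smul_eq_mul]
    ring
  have heq := hf.2 (x₁ := f + t • d) (x₂ := f + t • (-d))
    ⟨ht1, by simp [Finset.sum_add_distrib, ← Finset.mul_sum, hsum]⟩
    ⟨ht2, by simp [Finset.sum_add_distrib, ← Finset.mul_sum, hsum]⟩ hmem
  intro s
  have h := congrFun heq s
  simp only [Pi.add_apply, Pi.smul_apply, smul_eq_mul, add_eq_left, mul_eq_zero] at h
  rw [← hdg]
  exact h.resolve_left (ne_of_gt ht0)

/-- Capacities in general position: the restriction of `c` to a set of columns lies in no proper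
subspace spanned by restricted rows. -/
def IsGeneric (a : Matrix A U ℝ) (c : U → ℝ) : Prop :=
  ∀ (p : U → Prop) (S : Set A),
    (fun u : {u // p u} => c u) ∈ Submodule.span ℝ (restrictRow a p '' S) →
      Submodule.span ℝ (restrictRow a p '' S) = ⊤

/-- The bad capacities lie in finitely many proper subspaces, which have measure zero, while the box
of allowed capacities has positive volume. -/
theorem exists_isGeneric [Fintype U] (a : Matrix A U ℝ) {ε : ℝ} (hε : 0 < ε) :
    ∃ c : U → ℝ, IsGeneric a c ∧ ∀ u, 1 ≤ c u ∧ c u ≤ 1 + ε := by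
  classical
  let K : (U → Prop) × Set A → Submodule ℝ (U → ℝ) := fun x =>
    (Submodule.span ℝ (restrictRow a x.1 '' x.2)).comap
      (LinearMap.funLeft ℝ ℝ (Subtype.val : {u // x.1 u} → U))
  have hnull : MeasureTheory.volume (⋃ x : {x // K x ≠ ⊤}, (K x.1 : Set (U → ℝ))) = 0 :=
    MeasureTheory.measure_iUnion_null fun x =>
      MeasureTheory.Measure.addHaar_submodule _ _ x.2
  have hpos : MeasureTheory.volume (Set.Icc (fun _ : U => (1 : ℝ)) fun _ => 1 + ε) ≠ 0 := by
    rw [Real.volume_Icc_pi]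
    simp [hε]
  obtain ⟨c, hc, hcK⟩ : ∃ c ∈ Set.Icc (fun _ : U => (1 : ℝ)) (fun _ => 1 + ε),
      c ∉ ⋃ x : {x // K x ≠ ⊤}, (K x.1 : Set (U → ℝ)) := by
    by_contra! h
    exact hpos (MeasureTheory.measure_mono_null h hnull)
  refine ⟨c, fun p S hmem => ?_, fun u => ⟨hc.1 u, hc.2 u⟩⟩
  by_contra hne
  refine hcK (Set.mem_iUnion.2 ⟨⟨(p, S), fun htop => hne ?_⟩, hmem⟩)
  rw [eq_top_iff]
  intro y _
  obtain ⟨z, rfl⟩ := LinearMap.funLeft_surjective_of_injective ℝ ℝ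
    (Subtype.val : {u // p u} → U) Subtype.val_injective y
  have : z ∈ K (p, S) := htop ▸ Submodule.mem_top
  exact this

theorem exists_isMax_packing [Fintype U] {a : Matrix A U ℝ} {r : ℝ} (hr : 0 < r)
    (har : ∀ e, ∑ u, a e u = r) {c : U → ℝ} (hc : ∀ u, 0 ≤ c u) (R : Finset A) :
    ∃ f ∈ packing a c R, ∀ g ∈ packing a c R, ∑ e, g e ≤ ∑ e, f e :=
  (isCompact_packing hr har c R).exists_isMaxOn
    ⟨0, fun _ => le_rfl, fun _ _ => rfl, fun u => by simpa using hc u⟩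
    (f := fun f : A → ℝ => ∑ e, f e) (by fun_prop)

theorem exists_extreme_isMax_packing [Fintype U] {a : Matrix A U ℝ} {r : ℝ} (hr : 0 < r)
    (har : ∀ e, ∑ u, a e u = r) {c : U → ℝ} (hc : ∀ u, 0 ≤ c u) (R : Finset A) :
    ∃ f, f ∈ Set.extremePoints ℝ {g ∈ packing a c R | ∑ e, g e = ∑ e, f e} ∧
      ∀ g ∈ packing a c R, ∑ e, g e ≤ ∑ e, f e := by
  obtain ⟨f₀, hf₀, hmax⟩ := exists_isMax_packing hr har hc R
  have hcpt : IsCompact {g ∈ packing a c R | ∑ e, g e = ∑ e, f₀ e} :=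
    (isCompact_packing hr har c R).inter_right (isClosed_eq (by fun_prop) (by fun_prop))
  obtain ⟨f, hf⟩ := hcpt.extremePoints_nonempty ⟨f₀, hf₀, rfl⟩
  have h : ∑ e, f e = ∑ e, f₀ e := hf.1.2
  exact ⟨f, by rwa [h], by rwa [h]⟩

/-- Rainbow packings for generic capacities that are at least `1`. -/
theorem exists_transversal_packing_of_isGeneric [Fintype U] [Fintype ι] [Nonempty ι]
    {a : Matrix A U ℝ} (ha : ∀ e u, 0 ≤ a e u)
    {r : ℝ} (hr : 0 < r) (har : ∀ e, ∑ u, a e u = r) {c : U → ℝ} (hc : ∀ u, 1 ≤ c u)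
    (hgen : IsGeneric a c) {n : ℝ} (E : ι → Finset A) (hι : r * n ≤ Fintype.card ι)
    (hE : ∀ i, ∃ g ∈ packing a c (E i), n ≤ ∑ e, g e) :
    ∃ R, IsTransversal E R ∧ ∃ f ∈ packing a c R, n ≤ ∑ e, f e := by
  classical
  have hc0 : ∀ u, 0 ≤ c u := fun u => zero_le_one.trans (hc u)
  choose F hF hFmax using fun R => exists_extreme_isMax_packing hr har hc0 R
  have hempty : IsTransversal E ∅ := ⟨fun _ => Classical.arbitrary ι, by simp, by simp⟩
  obtain ⟨R, hR, hRmax⟩ := Finset.exists_max_image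
    (Finset.univ.filter fun R => IsTransversal E R) (fun R => ∑ e, F R e)
    ⟨∅, by simpa using hempty⟩
  simp only [Finset.mem_filter, Finset.mem_univ, true_and] at hR hRmax
  refine ⟨R, hR, F R, (hF R).1.1, ?_⟩
  by_contra! hlt
  set f := F R with hfdef
  have hfR : f ∈ packing a c R := (hF R).1.1
  have hbest : ∀ S, IsTransversal E S → ∀ g ∈ packing a c S, ∑ e, g e ≤ ∑ e, f e :=
    fun S hS g hg => (hFmax S g hg).trans (hRmax S hS)
  let p : U → Prop := fun u => (f ᵥ* a) u = c u
  have hli : LinearIndependent ℝ (fun s : {e // f e ≠ 0} => restrictRow a p s) :=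
    linearIndependent_of_extreme (hF R) (hFmax R)
  have hload : ∑ s : {e // f e ≠ 0}, f s • restrictRow a p s = fun u : {u // p u} => c u := by
    rw [← sum_support (fun e he => he), sum_smul_restrictRow]
    funext u
    exact u.2
  -- On the tight columns `c` is the combination of the support rows with weights `f`, so genericity
  -- applies.
  have hspan : Submodule.span ℝ (Set.range fun s : {e // f e ≠ 0} => restrictRow a p s) = ⊤ := by
    have hr' : (Set.range fun s : {e // f e ≠ 0} => restrictRow a p s)
        = restrictRow a p '' {e | f e ≠ 0} := by
      ext x; simp
    rw [hr']
    refine hgen p _ ?_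
    rw [← hload]
    exact Submodule.sum_mem _ fun s _ =>
      Submodule.smul_mem _ _ (Submodule.subset_span ⟨s, s.2, rfl⟩)
  let b := Module.Basis.mk hli hspan.ge
  let φ : ({u // p u} → ℝ) →ₗ[ℝ] ℝ := b.constr ℝ fun _ => 1
  have hφ : ∀ s : {e // f e ≠ 0}, φ (restrictRow a p s) = 1 := by
    intro s
    have : b s = restrictRow a p s := Module.Basis.mk_apply hli hspan.ge s
    rw [← this]
    exact b.constr_basis ℝ _ s
  have hφsum : ∀ d : A → ℝ, (∀ e, f e = 0 → d e = 0) →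
      φ (fun u : {u // p u} => (d ᵥ* a) u) = ∑ e, d e := by
    intro d hd
    have h := sum_support hd (fun _ => (1 : ℝ))
    simp only [smul_eq_mul, mul_one] at h
    rw [← sum_smul_restrictRow, sum_support hd, map_sum, h]
    simp [hφ]
  have hdir : ∀ x : {u // p u} → ℝ, ∃ d : A → ℝ, (∀ e, f e = 0 → d e = 0) ∧
      (∀ u : {u // p u}, (d ᵥ* a) u = x u) ∧ ∑ e, d e = φ x := by
    intro x
    obtain ⟨d, hd0, hdg⟩ := exists_extend_support f (b.repr x)
    have hx : (fun u : {u // p u} => (d ᵥ* a) u) = x := by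
      rw [← sum_smul_restrictRow, sum_support hd0]
      conv_rhs => rw [← b.sum_repr x]
      exact Finset.sum_congr rfl fun s _ => by
        rw [hdg, Module.Basis.mk_apply hli hspan.ge s]
    exact ⟨d, hd0, congrFun hx, by rw [← hφsum d hd0, hx]⟩
  -- Dual feasibility: a direction that raises no tight load cannot increase the optimal size.
  have hmono : ∀ x : {u // p u} → ℝ, x ≤ 0 → φ x ≤ 0 := by
    intro x hx
    obtain ⟨d, hd0, hdx, hds⟩ := hdir x
    rw [← hds]
    refine sum_nonpos_of_feasible_direction hfR (hbest R hR)
      (fun e he => ⟨hfR.2.1 e he, hd0 e (hfR.2.1 e he)⟩) (fun e he => (hd0 e he).ge)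
      (fun u hu => ?_)
    rw [hdx ⟨u, hu⟩]
    exact hx _
  let S : Finset A := Finset.univ.filter fun e => f e ≠ 0
  have hScard : S.card = Fintype.card {e // f e ≠ 0} := (Fintype.card_subtype _).symm
  -- Each tight column carries load at least `1`, and the loads add up to `r` times the size of `f`.
  have hcount : (S.card : ℝ) < Fintype.card ι := by
    have h1 : S.card ≤ Fintype.card {u // p u} := by
      have := hli.fintype_card_le_finrank
      rwa [Module.finrank_fintype_fun_eq_card, ← hScard] at this
    have h2 : (Fintype.card {u // p u} : ℝ) ≤ ∑ u, (f ᵥ* a) u := by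
      have hnn : ∀ u, 0 ≤ (f ᵥ* a) u := fun u =>
        Finset.sum_nonneg fun e _ => mul_nonneg (hfR.1 e) (ha e u)
      calc (Fintype.card {u // p u} : ℝ) = ∑ u ∈ Finset.univ.filter p, (1 : ℝ) := by
            simp [Fintype.card_subtype]
        _ ≤ ∑ u ∈ Finset.univ.filter p, (f ᵥ* a) u := by
            refine Finset.sum_le_sum fun u hu => ?_
            rw [(Finset.mem_filter.1 hu).2]
            exact hc u
        _ ≤ ∑ u, (f ᵥ* a) u :=
            Finset.sum_le_sum_of_subset_of_nonneg (Finset.filter_subset _ _) fun u _ _ => hnn u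
    rw [sum_load har] at h2
    calc (S.card : ℝ) ≤ Fintype.card {u // p u} := by exact_mod_cast h1
      _ ≤ r * ∑ e, f e := h2
      _ < r * n := by gcongr
      _ ≤ _ := hι
  have hSR : S ⊆ R := fun e he => by
    by_contra h
    exact (Finset.mem_filter.1 he).2 (hfR.2.1 e h)
  obtain ⟨σ, hσinj, hσE⟩ := hR.mono hSR
  obtain ⟨i, hi⟩ : ∃ i, i ∉ S.image σ := by
    by_contra! h
    have : Fintype.card ι ≤ S.card := by
      rw [← Finset.card_univ, ← Finset.eq_univ_of_forall h]
      exact Finset.card_image_le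
    exact absurd hcount (not_lt.2 (by exact_mod_cast this))
  -- The pivot: add `e` with the unused index `i` and cancel its tight load using the basis rows.
  -- The size would change at rate `1 - φ (restrictRow a p e)`, which must not be positive.
  have hcover : ∀ e ∈ E i, 1 ≤ φ (restrictRow a p e) := by
    intro e he
    by_contra! hlt1
    have hfe : f e = 0 := by
      by_contra h
      exact hlt1.ne (hφ ⟨e, h⟩)
    have heS : e ∉ S := by simp [S, hfe]
    have htr : IsTransversal E (insert e S) := by
      refine ⟨Function.update σ e i, ?_, ?_⟩
      · intro x hx y hy hxy
        simp only [Finset.coe_insert, Set.mem_insert_iff, Finset.mem_coe] at hx hy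
        by_cases hxe : x = e <;> by_cases hye : y = e
        · rw [hxe, hye]
        · rw [hxe, Function.update_self, Function.update_of_ne hye] at hxy
          exact absurd (hxy ▸ Finset.mem_image_of_mem σ (hy.resolve_left hye)) hi
        · rw [hye, Function.update_self, Function.update_of_ne hxe] at hxy
          exact absurd (hxy ▸ Finset.mem_image_of_mem σ (hx.resolve_left hxe)) hi
        · rw [Function.update_of_ne hxe, Function.update_of_ne hye] at hxy
          exact hσinj (hx.resolve_left hxe) (hy.resolve_left hye) hxy
      · intro x hx
        by_cases hxe : x = e
        · rw [hxe, Function.update_self]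
          exact he
        · rw [Function.update_of_ne hxe]
          exact hσE x ((Finset.mem_insert.1 hx).resolve_left hxe)
    obtain ⟨d, hd0, hdx, hds⟩ := hdir (-restrictRow a p e)
    have hle := sum_nonpos_of_feasible_direction (d := d + Pi.single e 1) hfR (hbest _ htr)
      (fun x hx => by
        simp only [Finset.mem_insert, not_or, S, Finset.mem_filter, Finset.mem_univ, true_and,
          not_not] at hx
        exact ⟨hx.2, by simp [hd0 x hx.2, Pi.single_eq_of_ne hx.1]⟩)
      (fun x hx => by
        rw [Pi.add_apply, hd0 x hx, zero_add]
        by_cases hxe : x = e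
        · subst hxe; simp
        · simp [Pi.single_eq_of_ne hxe])
      (fun u hu => by
        rw [Matrix.add_vecMul, Pi.add_apply, hdx ⟨u, hu⟩, Matrix.single_one_vecMul]
        simp [restrictRow])
    simp only [Pi.add_apply, Finset.sum_add_distrib, hds, map_neg, Finset.sum_pi_single',
      Finset.mem_univ, if_true] at hle
    linarith
  obtain ⟨g, hg, hgn⟩ := hE i
  -- Weak duality: the cover bounds `g` by `φ` of its load, and by `hmono` this is at most `φ` of
  -- the capacities, the size of `f`.
  have hge : ∑ e, g e ≤ φ (fun u : {u // p u} => (g ᵥ* a) u) := by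
    rw [← sum_smul_restrictRow, map_sum]
    refine Finset.sum_le_sum fun e _ => ?_
    rw [map_smul, smul_eq_mul]
    by_cases he : e ∈ E i
    · exact le_mul_of_one_le_right (hg.1 e) (hcover e he)
    · simp [hg.2.1 e he]
  have hle := hmono (fun u : {u // p u} => (g ᵥ* a) u - (f ᵥ* a) u) fun u => by
    have hu : (f ᵥ* a) u = c u := u.2
    simp only [hu, Pi.zero_apply, sub_nonpos]
    exact hg.2.2 u
  have hsub : φ (fun u : {u // p u} => (g ᵥ* a) u - (f ᵥ* a) u)
      = φ (fun u : {u // p u} => (g ᵥ* a) u) - ∑ e, f e := by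
    rw [← hφsum f fun e he => he, ← map_sub]
    rfl
  linarith

/-- Rainbow packings for unit capacities. -/
theorem exists_transversal_packing [Fintype U] [Fintype ι] [Nonempty ι]
    {a : Matrix A U ℝ} (ha : ∀ e u, 0 ≤ a e u)
    {r : ℝ} (hr : 0 < r) (har : ∀ e, ∑ u, a e u = r) {n : ℝ} (E : ι → Finset A)
    (hι : r * n ≤ Fintype.card ι)
    (hE : ∀ i, ∃ g ∈ packing a 1 (E i), n ≤ ∑ e, g e) :
    ∃ R, IsTransversal E R ∧ ∃ f ∈ packing a 1 R, n ≤ ∑ e, f e := by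
  classical
  by_contra! hcon
  choose F hF hFmax using fun R =>
    exists_isMax_packing hr har (c := 1) (fun _ => zero_le_one) R
  -- There are finitely many `R`, so one `ε` keeps all their optima below `n` even after scaling by
  -- `1 + ε`.
  have hev : ∀ᶠ ε : ℝ in 𝓝[>] 0, ∀ R, IsTransversal E R → (1 + ε) * ∑ e, F R e < n := by
    refine eventually_all.2 fun R => ?_
    by_cases hR : IsTransversal E R
    · have : Tendsto (fun ε : ℝ => (1 + ε) * ∑ e, F R e) (𝓝[>] 0)
          (𝓝 ((1 + 0) * ∑ e, F R e)) :=
        (Continuous.tendsto (by fun_prop) 0).mono_left nhdsWithin_le_nhds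
      rw [add_zero, one_mul] at this
      exact (this.eventually_lt_const (hcon R hR _ (hF R))).mono fun ε h _ => h
    · exact .of_forall fun ε h => absurd h hR
  obtain ⟨ε, hε, hε0⟩ := (hev.and self_mem_nhdsWithin).exists
  replace hε0 : 0 < ε := hε0
  obtain ⟨c, hgen, hc⟩ := exists_isGeneric a hε0
  obtain ⟨R, hR, f, hf, hfn⟩ := exists_transversal_packing_of_isGeneric ha hr har
    (fun u => (hc u).1) hgen E hι fun i => by
      obtain ⟨g, hg, hgn⟩ := hE i
      exact ⟨g, ⟨hg.1, hg.2.1, fun u => (hg.2.2 u).trans (hc u).1⟩, hgn⟩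
  have hpos : 0 < 1 + ε := by positivity
  have hmem : (1 + ε)⁻¹ • f ∈ packing a 1 R := by
    refine ⟨fun e => mul_nonneg (by positivity) (hf.1 e), fun e he => by simp [hf.2.1 e he],
      fun u => ?_⟩
    rw [Matrix.smul_vecMul, Pi.smul_apply, smul_eq_mul, inv_mul_le_iff₀ hpos]
    simpa using (hf.2.2 u).trans (hc u).2
  have h1 := hFmax R _ hmem
  simp only [Pi.smul_apply, smul_eq_mul, ← Finset.mul_sum] at h1
  rw [inv_mul_le_iff₀ hpos] at h1
  linarith [hε R hR]

end Packing

/-! ### From fractional matchings to packings of the incidence matrix -/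

section Incidence

variable {V : Type*}

open Classical in
/-- The incidence matrix of the edges in `W` and the vertices in `U`. -/
noncomputable def incidence (W : Finset (Set V)) (U : Finset V) : Matrix W U ℝ :=
  fun e u => if (u : V) ∈ (e : Set V) then 1 else 0

theorem vecMul_incidence (W : Finset (Set V)) (U : Finset V) (f : W → ℝ) (u : U) :
    (f ᵥ* incidence W U) u =
      open Classical in ∑ e : W, if (u : V) ∈ (e : Set V) then f e else 0 := by
  simp [Matrix.vecMul, dotProduct, incidence]

theorem sum_incidence {W : Finset (Set V)} {U : Finset V} {r : ℕ}
    (hU : ∀ e ∈ W, e ⊆ (U : Set V)) (hW : ∀ e ∈ W, e.encard = (r : ℕ∞)) (e : W) :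
    ∑ u, incidence W U e u = (r : ℝ) := by
  classical
  have h : (e : Set V) = ((U.filter fun u => u ∈ (e : Set V) : Finset V) : Set V) := by
    ext u
    simpa using fun hu => hU e e.2 hu
  have hcard := hW e e.2
  rw [h, Set.encard_coe_eq_coe_finsetCard] at hcard
  have hcard' : (U.filter fun u => u ∈ (e : Set V)).card = r := by exact_mod_cast hcard
  rw [← hcard', Finset.card_filter, Nat.cast_sum]
  simp only [incidence, Nat.cast_ite, Nat.cast_one, Nat.cast_zero]
  exact Finset.sum_coe_sort U fun u => if u ∈ (e : Set V) then (1 : ℝ) else 0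

theorem IsTransversal.isRainbow {ι : Type*} {W : Finset (Set V)} {E' : ι → Finset W}
    {E : ι → Finset (Set V)} {R : Finset W} (h : IsTransversal E' R)
    (hE : ∀ i, (E' i).map (Function.Embedding.subtype _) = E i) :
    IsRainbow E (R.map (Function.Embedding.subtype _)) := by
  obtain ⟨σ, hσ, hσE⟩ := h
  have hmem : ∀ e : R.map (Function.Embedding.subtype (· ∈ W)), ∃ x ∈ R, (x : Set V) = e :=
    fun e => Finset.mem_map.1 e.2
  choose x hx hxe using hmem
  refine ⟨fun e => σ (x e), fun e e' h => Subtype.ext ?_, fun e => ?_⟩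
  · rw [← hxe e, ← hxe e', hσ (hx e) (hx e') h]
  · rw [← hE, ← hxe e]
    exact Finset.mem_map_of_mem (Function.Embedding.subtype _) (hσE _ (hx e))

section Transfer

variable {W : Finset (Set V)} {U : Finset V} {F : Finset W} {g : W → ℝ} {f : Set V → ℝ}

theorem sum_eq_size (hgf : ∀ e ∈ F, g e = f e) (hg : ∀ e, e ∉ F → g e = 0) :
    ∑ e, g e = size (F.map (Function.Embedding.subtype _)) f := by
  rw [size, Finset.sum_map, ← Finset.sum_subset (Finset.subset_univ F) fun e _ => hg e]
  exact Finset.sum_congr rfl hgf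

theorem mem_packing_incidence_iff (hU : ∀ e ∈ W, e ⊆ (U : Set V))
    (hgf : ∀ e ∈ F, g e = f e) (hg : ∀ e, e ∉ F → g e = 0) :
    g ∈ packing (incidence W U) 1 F ↔
      IsFractionalMatching (F.map (Function.Embedding.subtype _)) f := by
  classical
  have hload : ∀ v : V, ∑ e ∈ F.map (Function.Embedding.subtype _) with v ∈ e, f e
      = ∑ e : W, if v ∈ (e : Set V) then g e else 0 := by
    intro v
    rw [Finset.sum_filter, Finset.sum_map,
      ← Finset.sum_subset (Finset.subset_univ F) fun e _ he => by simp [hg e he]]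
    exact Finset.sum_congr rfl fun e he => by
      rw [hgf e he]
      congr
  constructor
  · intro h
    refine ⟨fun e he => ?_, fun v => ?_⟩
    · obtain ⟨x, hx, rfl⟩ := Finset.mem_map.1 he
      exact (h.1 x).trans_eq (hgf x hx)
    · by_cases hv : v ∈ U
      · have := h.2.2 ⟨v, hv⟩
        rw [vecMul_incidence] at this
        refine le_trans (le_of_eq ?_) this
        convert hload v
      · have h0 : ∑ e : W, (if v ∈ (e : Set V) then g e else 0) = 0 :=
          Finset.sum_eq_zero fun e _ => if_neg fun hve => hv (hU e e.2 hve)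
        have := (hload v).trans h0
        refine le_trans (le_of_eq ?_) zero_le_one
        convert this
  · intro h
    refine ⟨fun e => ?_, hg, fun u => ?_⟩
    · by_cases he : e ∈ F
      · rw [hgf e he]
        exact h.1 e (Finset.mem_map_of_mem (Function.Embedding.subtype _) he)
      · exact (hg e he).ge
    · have := h.2 u
      rw [vecMul_incidence]
      refine le_trans (le_of_eq ?_) this
      convert (hload u).symm

/-- The fractional matching number is the value of a packing problem, and it is attained. -/
theorem exists_packing_fracMatchingNumber (hU : ∀ e ∈ W, e ⊆ (U : Set V)) {r : ℕ} (hr : 0 < r)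
    (hW : ∀ e ∈ W, e.encard = (r : ℕ∞)) (F : Finset W) :
    ∃ g ∈ packing (incidence W U) 1 F,
      ∑ e, g e = fracMatchingNumber (F.map (Function.Embedding.subtype _)) := by
  classical
  have hset : {s : ℝ | ∃ f : Set V → ℝ,
      IsFractionalMatching (F.map (Function.Embedding.subtype _)) f ∧
        size (F.map (Function.Embedding.subtype _)) f = s}
      = (fun g : W → ℝ => ∑ e, g e) '' packing (incidence W U) 1 F := by
    ext s
    constructor
    · rintro ⟨f, hf, rfl⟩
      have h1 : ∀ e ∈ F, (fun e : W => if e ∈ F then f e else 0) e = f e :=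
        fun e he => if_pos he
      have h2 : ∀ e, e ∉ F → (fun e : W => if e ∈ F then f e else 0) e = 0 :=
        fun e he => if_neg he
      exact ⟨_, (mem_packing_incidence_iff hU h1 h2).2 hf, sum_eq_size h1 h2⟩
    · rintro ⟨g, hg, rfl⟩
      have h1 : ∀ e ∈ F, g e = Function.extend Subtype.val g 0 (e : Set V) :=
        fun e _ => (Subtype.val_injective.extend_apply g 0 e).symm
      exact ⟨_, (mem_packing_incidence_iff hU h1 hg.2.1).1 hg, (sum_eq_size h1 hg.2.1).symm⟩
  have hcpt := (isCompact_packing (by exact_mod_cast hr) (sum_incidence hU hW) 1 F).image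
    (f := fun g : W → ℝ => ∑ e, g e) (by fun_prop)
  have hmem := hcpt.sSup_mem (Set.Nonempty.image _
    ⟨0, fun _ => le_rfl, fun _ _ => rfl, fun u => by simp⟩)
  obtain ⟨g, hg, hgs⟩ := hmem
  refine ⟨g, hg, ?_⟩
  rw [fracMatchingNumber, hset]
  exact hgs

end Transfer

end Incidence

end RainbowFractional

theorem theorem4 {V : Type*} (H : Hypergraph V) (r : ℕ) (hr : 2 ≤ r)
    (hH : RainbowFractional.IsUniform H r) (n : ℚ) (hn : 0 < n)
    (E : Fin ⌈(r : ℚ) * n⌉₊ → Finset (Set V))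
    (hE : ∀ i, (E i : Set (Set V)) ⊆ H.edgeSet)
    (hν : ∀ i, (n : ℝ) ≤ RainbowFractional.fracMatchingNumber (E i)) :
    RainbowFractional.HasRainbowFractionalMatching E (n : ℝ) := by
  classical
  have hr0 : 0 < r := by omega
  have hn' : (0 : ℝ) < n := by exact_mod_cast hn
  have hm : 0 < ⌈(r : ℚ) * n⌉₊ := Nat.ceil_pos.2 (by positivity)
  have : Nonempty (Fin ⌈(r : ℚ) * n⌉₊) := ⟨⟨0, hm⟩⟩
  -- `V` may be infinite; only the finitely many edges in the family and the vertices they cover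
  -- matter.
  let W : Finset (Set V) := Finset.univ.biUnion E
  have hW : ∀ e ∈ W, e.encard = (r : ℕ∞) := by
    intro e he
    obtain ⟨i, -, hi⟩ := Finset.mem_biUnion.1 he
    exact hH e (hE i hi)
  have hfin : (⋃ e ∈ W, e).Finite := W.finite_toSet.biUnion fun e he =>
    Set.finite_of_encard_eq_coe (hW e he)
  let U : Finset V := hfin.toFinset
  have hU : ∀ e ∈ W, e ⊆ (U : Set V) := by
    intro e he
    rw [hfin.coe_toFinset]
    exact Set.subset_biUnion_of_mem (u := fun e : Set V => e) he
  let E' : Fin ⌈(r : ℚ) * n⌉₊ → Finset W := fun i => (E i).subtype (· ∈ W)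
  have hE' : ∀ i, (E' i).map (Function.Embedding.subtype _) = E i := fun i =>
    Finset.subtype_map_of_mem fun e he => Finset.mem_biUnion.2 ⟨i, Finset.mem_univ i, he⟩
  have hι : (r : ℝ) * n ≤ Fintype.card (Fin ⌈(r : ℚ) * n⌉₊) := by
    rw [Fintype.card_fin]
    exact_mod_cast Nat.le_ceil ((r : ℚ) * n)
  obtain ⟨R, hR, f, hf, hfn⟩ := RainbowFractional.exists_transversal_packing
    (a := RainbowFractional.incidence W U)
    (fun e u => by unfold RainbowFractional.incidence; positivity)
    (by exact_mod_cast hr0) (RainbowFractional.sum_incidence hU hW) E' hι fun i => by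
      obtain ⟨g, hg, hgn⟩ :=
        RainbowFractional.exists_packing_fracMatchingNumber hU hr0 hW (E' i)
      exact ⟨g, hg, by rw [hgn, hE']; exact hν i⟩
  set s := ∑ e, f e with hs
  have hs0 : 0 < s := hn'.trans_le hfn
  -- The packing found has size `s ≥ n`; scaling it down gives size exactly `n`.
  have hg : ((n : ℝ) / s) • f ∈ RainbowFractional.packing (RainbowFractional.incidence W U) 1 R := by
    refine ⟨fun e => mul_nonneg (by positivity) (hf.1 e), fun e he => by simp [hf.2.1 e he],
      fun u => ?_⟩
    rw [Matrix.smul_vecMul, Pi.smul_apply, smul_eq_mul]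
    have h1 : (n : ℝ) / s ≤ 1 := (div_le_one hs0).2 hfn
    calc (n : ℝ) / s * (Matrix.vecMul f (RainbowFractional.incidence W U)) u ≤ (n : ℝ) / s * 1 := by
          gcongr
          exact hf.2.2 u
      _ ≤ 1 := by rwa [mul_one]
  set g := ((n : ℝ) / s) • f with hgdef
  have hext : ∀ e ∈ R, g e = Function.extend Subtype.val g 0 (e : Set V) :=
    fun e _ => (Subtype.val_injective.extend_apply g 0 e).symm
  refine ⟨R.map (Function.Embedding.subtype _), Function.extend Subtype.val g 0,
    RainbowFractional.IsTransversal.isRainbow hR hE',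
    (RainbowFractional.mem_packing_incidence_iff hU hext hg.2.1).1 hg, ?_⟩
  · rw [← RainbowFractional.sum_eq_size hext hg.2.1]
    simp only [hgdef, Pi.smul_apply, smul_eq_mul, ← Finset.mul_sum]
    rw [← hs]
    field_simp
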